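/- Let $\bar A_i\in\mathbb R^{k_i\times n}$, $\bar b_i\in\mathbb R^{k_i}$, $Q_i\subset\mathbb R^{k_i}$ and $\Delta\mathcal U_i\subset\mathbb R^{k_i\times n}\times\mathbb R^{k_i}$ for $1\le i\le m$, with $(0,0)\in\Delta\mathcal U_i$ (the nominal data belong to the uncertainty set), and let $f:\mathbb R^n\to\mathbb R$. For $\epsilon>0$ consider the robust problem $$(R_\epsilon)\qquad \min_x f(x)\quad\text{s.t. }[\bar A_i+\Delta A_i]x-[\bar b_i+\Delta b_i]\in Q_i\ \text{ for all }(\Delta A_i,\Delta b_i)\in\epsilon\,\Delta\mathcal U_i\text{ and all }i.$$ Let $\Phi=\{x\mid \bar A_ix-\bar b_i\in Q_i\text{ for all }i\}$, let $\bar x$ be an optimal solution of the nominal problem $\min\{f(x)\mid x\in\Phi\}$, and let $\bar v=f(\bar x)$ be its value. With the subderivative $df(\bar x)(\gamma)=\liminf_{\tau\searrow0}\frac{f(\bar x+\tau\gamma)-f(\bar x)}{\tau}$ and the tangent cone $T_C(z)=\{w\mid \frac{z_j-z}{t_j}\to w\text{ for some }z_j\in C,\ z_j\to z,\ t_j\searrow0\}$,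 the tangential problem is $$(T)\qquad\min_\gamma df(\bar x)(\gamma)\quad\text{s.t. }\bar A_i\gamma+[(\Delta A_i)\bar x-\Delta b_i]\in T_{Q_i}(\bar A_i\bar x-\bar b_i)\ \text{ for all }(\Delta A_i,\Delta b_i)\in\Delta\mathcal U_i\text{ and all }i.$$ Let $\bar\Gamma$ be the set of optimal solutions of $(T)$. A set $C$ is Clarke regular at $z\in C$ if $N_C(z)=\hat N_C(z)$, where $\hat N_C(z)$ is the set of $v$ with $\langle v,y-z\rangle\le o(|y-z|)$ for $y\in C$, and $N_C(z)$ is the set of limits of sequences $v_j\in\hat N_C(z_j)$ with $z_j\in C$, $z_j\to z$. Suppose that 1. the $Q_i$ are closed and Clarke regular at $\bar A_i\bar x-\bar b_i$; 2. the $\Delta\mathcal U_i$ are compact and convex; 3. $\bar\Gamma$ is bounded; 4. there is $\gamma'$ with $\bar A_i\gamma'\in\operatorname{int}T_{Q_i}(\bar A_i\bar x-\bar b_i)$ for all $i$; 5. if $x_j\in\Phi$ and $f(x_j)\to f(\bar x)$, then $x_j\to\bar x$; 6. $f$ is Lipschitz near $\bar x$ and subdifferentially regular at $\bar x$, i.e.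 the epigraph $\{(x,t)\mid t\ge f(x)\}\subset\mathbb R^n\times\mathbb R$ is Clarke regular at $(\bar x,f(\bar x))$. Then $(R_\epsilon)$ has an optimal solution for all sufficiently small $\epsilon>0$. If $\epsilon_j\searrow0$ and $\bar x_{\epsilon_j}$ is an optimal solution of $(R_{\epsilon_j})$, then every cluster point of $\frac1{\epsilon_j}(\bar x_{\epsilon_j}-\bar x)$ lies in $\bar\Gamma$. If $\bar\Gamma\neq\emptyset$, then the optimal value $\bar v_\epsilon$ of $(R_\epsilon)$ satisfies $$\bar v_\epsilon=\bar v+\epsilon\tilde v+o(\epsilon)\qquad(\epsilon\searrow0),$$ where $\tilde v$ is the optimal value of $(T)$. In particular, if $\bar\Gamma=\{\bar\gamma\}$, then $\lim_{\epsilon\searrow0}\frac1\epsilon(\bar x_\epsilon-\bar x)=\bar\gamma$, i.e. $\bar x_\epsilon=\bar x+\epsilon\bar\gamma+o(\epsilon)$, for optimal solutions $\bar x_\epsilon$ of $(R_\epsilon)$ (along any sequence $\epsilon_j\searrow0$, and for any family defined for all small $\epsilon>0$). -/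

import Mathlib

open Filter Topology Set Asymptotics
open scoped Pointwise

namespace RobustOpt

section VariationalAnalysis

/-- The tangent cone (contingent cone) of `C` at `x`: all limits of `(x_j - x) / t_j` with
`x_j ∈ C`, `x_j → x` and `t_j ↘ 0`. -/
def tangentCone {E : Type*} [NormedAddCommGroup E] [NormedSpace ℝ E] (C : Set E) (x : E) : Set E :=
  {w | ∃ (y : ℕ → E) (t : ℕ → ℝ), (∀ j, y j ∈ C) ∧ (∀ j, 0 < t j) ∧
    Tendsto t atTop (𝓝 0) ∧ Tendsto y atTop (𝓝 x) ∧
    Tendsto (fun j => (t j)⁻¹ • (y j - x)) atTop (𝓝 w)}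

variable {E : Type*} [NormedAddCommGroup E] [InnerProductSpace ℝ E]

/-- Regular normals to `C` at `x`: `⟨v, y - x⟩ ≤ o(|y - x|)` for `y ∈ C`. -/
def regularNormalCone (C : Set E) (x : E) : Set E :=
  {v | ∀ η : ℝ, 0 < η → ∀ᶠ y in 𝓝[C] x, inner ℝ v (y - x) ≤ η * ‖y - x‖}

/-- (General, limiting) normals to `C` at `x`: limits of regular normals at points of `C`
converging to `x`. -/
def normalCone (C : Set E) (x : E) : Set E :=
  {v | ∃ (y : ℕ → E) (u : ℕ → E), (∀ j, y j ∈ C) ∧ (∀ j, u j ∈ regularNormalCone C (y j)) ∧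
    Tendsto y atTop (𝓝 x) ∧ Tendsto u atTop (𝓝 v)}

/-- `C` is Clarke regular at the point `x ∈ C`. -/
def ClarkeRegularAt (C : Set E) (x : E) : Prop :=
  x ∈ C ∧ normalCone C x = regularNormalCone C x

/-- The epigraph of `f`, in `E × ℝ` with its Euclidean structure. -/
def epi (f : E → ℝ) : Set (WithLp 2 (E × ℝ)) :=
  {p | f p.fst ≤ p.snd}

/-- `f` is Lipschitz on some neighbourhood of `x`. -/
def LocallyLipschitzAt (f : E → ℝ) (x : E) : Prop :=
  ∃ K : NNReal, ∃ s ∈ 𝓝 x, LipschitzOnWith K f s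

/-- Subdifferential regularity of `f` at `x`: its epigraph is Clarke regular at `(x, f x)`. -/
def SubdiffRegularAt (f : E → ℝ) (x : E) : Prop :=
  ClarkeRegularAt (epi f) (WithLp.toLp 2 (x, f x))

/-- The subderivative `df(x)(w) = liminf_{τ ↘ 0} (f (x + τ w) - f x) / τ`.  It is only used for
functions that are Lipschitz near `x`, where the difference quotients are bounded. -/
noncomputable def subderiv (f : E → ℝ) (x w : E) : ℝ :=
  liminf (fun τ : ℝ => (f (x + τ • w) - f x) / τ) (𝓝[>] 0)

end VariationalAnalysis

section Optimization

/-- The set of optimal solutions of `min {f x | x ∈ S}`. -/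
def solutions {X : Type*} (f : X → ℝ) (S : Set X) : Set X :=
  {x | x ∈ S ∧ ∀ y ∈ S, f x ≤ f y}

/-- The optimal value of `min {f x | x ∈ S}`; meaningful if `S` is nonempty and `f` is bounded
below on `S`. -/
noncomputable def optValue {X : Type*} (f : X → ℝ) (S : Set X) : ℝ :=
  sInf (f '' S)

variable {n m : ℕ} {k : Fin m → ℕ}

/-- The nominal feasible set `{x | A_i x - b_i ∈ Q_i for all i}`. -/
def nominalSet
    (A : (i : Fin m) → Matrix (Fin (k i)) (Fin n) ℝ) (b : (i : Fin m) → EuclideanSpace ℝ (Fin (k i)))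
    (Q : (i : Fin m) → Set (EuclideanSpace ℝ (Fin (k i)))) : Set (EuclideanSpace ℝ (Fin n)) :=
  {x | ∀ i, (A i).toEuclideanLin x - b i ∈ Q i}

/-- The robustly feasible set: all `x` with `[A_i + ΔA_i] x - [b_i + Δb_i] ∈ Q_i` for all `i` and
all `(ΔA_i, Δb_i) ∈ U_i`. -/
def robustSet
    (A : (i : Fin m) → Matrix (Fin (k i)) (Fin n) ℝ) (b : (i : Fin m) → EuclideanSpace ℝ (Fin (k i)))
    (Q : (i : Fin m) → Set (EuclideanSpace ℝ (Fin (k i))))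
    (U : (i : Fin m) → Set (Matrix (Fin (k i)) (Fin n) ℝ × EuclideanSpace ℝ (Fin (k i)))) :
    Set (EuclideanSpace ℝ (Fin n)) :=
  {x | ∀ i, ∀ u ∈ U i, (A i + u.1).toEuclideanLin x - (b i + u.2) ∈ Q i}

/-- The feasible set of the tangential problem at `xbar`: all `γ` with
`A_i γ + [(ΔA_i) xbar - Δb_i] ∈ T_{Q_i}(A_i xbar - b_i)` for all `i` and `(ΔA_i, Δb_i) ∈ U_i`. -/
def tangentialSet
    (A : (i : Fin m) → Matrix (Fin (k i)) (Fin n) ℝ) (b : (i : Fin m) → EuclideanSpace ℝ (Fin (k i)))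
    (Q : (i : Fin m) → Set (EuclideanSpace ℝ (Fin (k i))))
    (U : (i : Fin m) → Set (Matrix (Fin (k i)) (Fin n) ℝ × EuclideanSpace ℝ (Fin (k i))))
    (xbar : EuclideanSpace ℝ (Fin n)) : Set (EuclideanSpace ℝ (Fin n)) :=
  {γ | ∀ i, ∀ u ∈ U i, (A i).toEuclideanLin γ + (u.1.toEuclideanLin xbar - u.2) ∈
    tangentCone (Q i) ((A i).toEuclideanLin xbar - b i)}

end Optimization

end RobustOpt

open RobustOpt

/-!
Everything rests on one consequence of Clarke regularity (`ClarkeRegularAt.eventually_add_smul_mem`):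
if `C` is closed near `z` and regular at `z`, and the tangent cone `T` of `C` at `z` has an interior,
then adding a positive multiple of an interior tangent vector to any vector polar to the normal cone
gives a direction `w` such that `C` contains `z + t w'` for all small `t > 0` and all `w'` near `w`.
Indeed such a `w` makes a strictly obtuse angle with all limiting normals at `z`, hence, by
compactness of the unit sphere, an obtuse angle with all normals at nearby points, and so the
distance to `C` cannot grow along a segment in the direction `w'` (`eventually_add_smul_mem`).  In
particular `T` is the polar of the normal cone (`ClarkeRegularAt.mem_tangentCone_iff`).

For the sets `Q i` this shows that, for `γ` feasible in the tangential problem and `γ'` from the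
constraint qualification, `xbar + ε (γ + s γ')` is robustly feasible for all small `ε`, while
conversely every limit of scaled feasible displacements satisfies the tangential constraints.  For
the epigraph of `f`, whose tangent cone has the vertical direction in its interior, it
shows that the subderivative is a full limit, uniform under perturbation of the direction
(`SubdiffRegularAt.tendsto_quotient`), and sublinear.

These facts are collected in `FirstOrderModel`, from which the assertions follow.  Solutions exist
because the compactness condition confines minimizing sequences to a small ball.  Cluster points of
the scaled displacements of solutions are feasible for the tangential problem, and optimal by
comparison with the approximations of all competitors.  If the tangential problem has a nonempty
bounded set of solutions, the scaled displacements are bounded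
(`FirstOrderModel.exists_eventually_norm_le`), since otherwise a limit of their normalizations would
be a direction of recession along which the subderivative does not increase.  The expansions of the
optimal value and of the solutions follow by passing to ultrafilters.
-/

namespace RobustOpt

/-! ### Tangent cones at Clarke regular points -/

section TangentCone

variable {E : Type*} [NormedAddCommGroup E] [InnerProductSpace ℝ E] {C : Set E} {z : E}

/-- Tangent directions make an obtuse angle with regular normals.  The statement with an arbitrary
filter covers sequences as well as ultrafilters. -/
lemma inner_nonpos_of_tendsto {ι : Type*} {l : Filter ι} [l.NeBot] {v w₀ : E}
    (hv : v ∈ regularNormalCone C z) {t : ι → ℝ} {w : ι → E} (ht : Tendsto t l (𝓝[>] 0))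
    (hw : Tendsto w l (𝓝 w₀)) (hC : ∀ᶠ i in l, z + t i • w i ∈ C) : inner ℝ v w₀ ≤ 0 := by
  have ht0 : Tendsto t l (𝓝 0) := ht.mono_right nhdsWithin_le_nhds
  have hpos : ∀ᶠ i in l, 0 < t i := ht.eventually self_mem_nhdsWithin
  have hz : Tendsto (fun i => z + t i • w i) l (𝓝[C] z) := by
    refine tendsto_nhdsWithin_iff.2 ⟨?_, hC⟩
    simpa using (ht0.smul hw).const_add z
  have key : ∀ η : ℝ, 0 < η → inner ℝ v w₀ ≤ η * ‖w₀‖ := by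
    intro η hη
    refine le_of_tendsto_of_tendsto (tendsto_const_nhds.inner hw) (hw.norm.const_mul η) ?_
    filter_upwards [hz.eventually (hv η hη), hpos] with i hi hti
    rw [add_sub_cancel_left, inner_smul_right, norm_smul, Real.norm_of_nonneg hti.le] at hi
    refine le_of_mul_le_mul_left ?_ hti
    linarith
  have h0 : Tendsto (fun η : ℝ => η * ‖w₀‖) (𝓝[>] 0) (𝓝 0) := by
    have : Tendsto (fun η : ℝ => η * ‖w₀‖) (𝓝 0) (𝓝 (0 * ‖w₀‖)) := tendsto_id.mul_const _
    rw [zero_mul] at this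
    exact this.mono_left nhdsWithin_le_nhds
  exact ge_of_tendsto h0 (by filter_upwards [self_mem_nhdsWithin] with η hη using key η hη)

lemma inner_nonpos_of_mem_tangentCone {v w : E} (hv : v ∈ regularNormalCone C z)
    (hw : w ∈ tangentCone C z) : inner ℝ v w ≤ 0 := by
  obtain ⟨y, t, hy, ht, ht0, -, hw⟩ := hw
  refine inner_nonpos_of_tendsto hv (tendsto_nhdsWithin_iff.2 ⟨ht0, .of_forall ht⟩) hw
    (.of_forall fun j => ?_)
  rw [smul_inv_smul₀ (ht j).ne', add_sub_cancel]
  exact hy j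

lemma inner_neg_of_mem_interior {v w : E} (hv : v ∈ regularNormalCone C z) (hv0 : v ≠ 0)
    (hw : w ∈ interior (tangentCone C z)) : inner ℝ v w < 0 := by
  have hc : Tendsto (fun s : ℝ => w + s • v) (𝓝[>] 0) (𝓝 w) := by
    have : Continuous fun s : ℝ => w + s • v := by fun_prop
    simpa using (this.tendsto 0).mono_left nhdsWithin_le_nhds
  obtain ⟨s, hs, hs0⟩ :=
    ((hc.eventually (mem_interior_iff_mem_nhds.1 hw)).and self_mem_nhdsWithin).exists
  have := inner_nonpos_of_mem_tangentCone hv hs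
  rw [inner_add_right, inner_smul_right, real_inner_self_eq_norm_sq] at this
  have h2 : 0 < s * ‖v‖ ^ 2 := mul_pos hs0 (by positivity)
  linarith

lemma smul_mem_regularNormalCone {v : E} (hv : v ∈ regularNormalCone C z) {c : ℝ} (hc : 0 < c) :
    c • v ∈ regularNormalCone C z := by
  intro η hη
  filter_upwards [hv (η / c) (by positivity)] with y hy
  rw [real_inner_smul_left]
  calc c * inner ℝ v (y - z) ≤ c * (η / c * ‖y - z‖) := by gcongr
    _ = η * ‖y - z‖ := by field_simp

/-- If every `w j` is an admissible direction of `C` at `z` and `w j → w`, then `w` is tangent. -/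
lemma mem_tangentCone_of_eventually {w : ℕ → E} {w₀ : E} (hw : Tendsto w atTop (𝓝 w₀))
    (h : ∀ j, ∀ᶠ t : ℝ in 𝓝[>] 0, z + t • w j ∈ C) : w₀ ∈ tangentCone C z := by
  have : ∀ j : ℕ, ∃ t : ℝ, z + t • w j ∈ C ∧ 0 < t ∧ t < 1 / ((j : ℝ) + 1) := by
    intro j
    have hj : (0 : ℝ) < 1 / ((j : ℝ) + 1) := by positivity
    obtain ⟨t, h1, h2⟩ := ((h j).and (Ioo_mem_nhdsGT hj)).exists
    exact ⟨t, h1, h2⟩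
  choose t ht ht0 ht1 using this
  have htend : Tendsto t atTop (𝓝 0) :=
    squeeze_zero (fun j => (ht0 j).le) (fun j => (ht1 j).le) tendsto_one_div_add_atTop_nhds_zero_nat
  refine ⟨fun j => z + t j • w j, t, ht, ht0, htend, ?_, ?_⟩
  · simpa using (htend.smul hw).const_add z
  · simpa [inv_smul_smul₀ (ht0 _).ne'] using hw

/-- A proximal normal is a regular normal: if `p` is nearest to `y` among the points of `C` in a
neighbourhood of `p`, then `y - p` is normal to `C` at `p`. -/
lemma sub_mem_regularNormalCone {y p : E} (h : ∀ᶠ q in 𝓝[C] p, dist y p ≤ dist y q) :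
    y - p ∈ regularNormalCone C p := by
  intro η hη
  have hb : ∀ᶠ q in 𝓝[C] p, dist q p < 2 * η :=
    nhdsWithin_le_nhds (Metric.ball_mem_nhds p (by positivity))
  filter_upwards [h, hb] with q hq hqη
  rw [dist_eq_norm] at hqη
  rw [dist_eq_norm, dist_eq_norm] at hq
  have h1 : ‖y - q‖ ^ 2 = ‖y - p‖ ^ 2 - 2 * inner ℝ (y - p) (q - p) + ‖q - p‖ ^ 2 := by
    rw [← norm_sub_sq_real]; congr 2; abel
  have h2 : ‖y - p‖ ^ 2 ≤ ‖y - q‖ ^ 2 := by gcongr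
  nlinarith [norm_nonneg (q - p)]

/-- If `w` makes a strictly obtuse angle with all limiting normals at `z`, then directions near `w`
make an obtuse angle with all regular normals at points near `z`. -/
lemma exists_forall_inner_nonpos [FiniteDimensional ℝ E] {w : E}
    (hw : ∀ v ∈ normalCone C z, v ≠ 0 → inner ℝ v w < 0) :
    ∃ δ > 0, ∀ p ∈ C, dist p z < δ → ∀ v ∈ regularNormalCone C p, ∀ w', dist w' w < δ →
      inner ℝ v w' ≤ 0 := by
  by_contra! hcon
  choose p hpC hpz v hv w' hw' hin using fun j : ℕ =>
    hcon (1 / ((j : ℝ) + 1)) (by positivity)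
  have hlim := tendsto_one_div_add_atTop_nhds_zero_nat (𝕜 := ℝ)
  have hp : Tendsto p atTop (𝓝 z) := tendsto_iff_dist_tendsto_zero.2
    (squeeze_zero (fun _ => dist_nonneg) (fun j => (hpz j).le) hlim)
  have hww : Tendsto w' atTop (𝓝 w) := tendsto_iff_dist_tendsto_zero.2
    (squeeze_zero (fun _ => dist_nonneg) (fun j => (hw' j).le) hlim)
  have hv0 : ∀ j, 0 < ‖v j‖ := fun j => norm_pos_iff.2 fun h => by simpa [h] using hin j
  have hmem : ∀ j, ‖v j‖⁻¹ • v j ∈ Metric.sphere (0 : E) 1 := fun j => by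
    simp [norm_smul, inv_mul_cancel₀ (hv0 j).ne']
  obtain ⟨u, hu, φ, hφ, hlimu⟩ := (isCompact_sphere (0 : E) 1).tendsto_subseq hmem
  have huN : u ∈ normalCone C z := ⟨p ∘ φ, fun j => ‖v (φ j)‖⁻¹ • v (φ j), fun j => hpC _,
    fun j => smul_mem_regularNormalCone (hv _) (inv_pos.2 (hv0 _)),
    hp.comp hφ.tendsto_atTop, hlimu⟩
  have hu0 : u ≠ 0 := by
    rintro rfl
    simp at hu
  have h0 : 0 ≤ inner ℝ u w := by
    refine ge_of_tendsto' (hlimu.inner (hww.comp hφ.tendsto_atTop)) fun j => ?_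
    simp only [Function.comp_apply, real_inner_smul_left]
    exact mul_nonneg (inv_nonneg.2 (norm_nonneg _)) (hin _).le
  exact absurd (hw u huN hu0) (not_lt.2 h0)

/-- If `C` is closed near `z` and `w` makes a strictly obtuse angle with all limiting normals at
`z`, then `C` contains all short segments from `z` in directions near `w`.  Along such a segment,
a step of length `s` increases the squared distance to `C` by at most `s² ‖w'‖²`, because the
vector from the nearest point is a normal; hence a path cut into `N` steps ends at a squared
distance of order `1 / N`. -/
lemma eventually_add_smul_mem [FiniteDimensional ℝ E] {r : ℝ} (hr : 0 < r) (hz : z ∈ C)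
    (hC : IsClosed (C ∩ Metric.closedBall z r)) {w : E}
    (hw : ∀ v ∈ normalCone C z, v ≠ 0 → inner ℝ v w < 0) :
    ∀ᶠ q : ℝ × E in 𝓝[>] 0 ×ˢ 𝓝 w, z + q.1 • q.2 ∈ C := by
  obtain ⟨δ, hδ, hδ'⟩ := exists_forall_inner_nonpos hw
  set D := C ∩ Metric.closedBall z r with hD
  have hzD : z ∈ D := ⟨hz, by simp [hr.le]⟩
  have hsmall : ∀ᶠ q : ℝ × E in 𝓝[>] 0 ×ˢ 𝓝 w, q.1 * ‖q.2‖ < min δ r / 2 := by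
    have : Tendsto (fun q : ℝ × E => q.1 * ‖q.2‖) (𝓝[>] 0 ×ˢ 𝓝 w) (𝓝 (0 * ‖w‖)) :=
      (tendsto_fst.mono_right nhdsWithin_le_nhds).mul tendsto_snd.norm
    rw [zero_mul] at this
    exact this.eventually (gt_mem_nhds (by positivity))
  have hpos : ∀ᶠ q : ℝ × E in 𝓝[>] 0 ×ˢ 𝓝 w, 0 < q.1 :=
    tendsto_fst.eventually self_mem_nhdsWithin
  have hnear : ∀ᶠ q : ℝ × E in 𝓝[>] 0 ×ˢ 𝓝 w, dist q.2 w < δ :=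
    tendsto_snd.eventually (Metric.ball_mem_nhds w hδ)
  filter_upwards [hsmall, hpos, hnear] with ⟨T, w'⟩ h1 h2 h3
  simp only at h1 h2 h3 ⊢
  have step : ∀ t s : ℝ, 0 ≤ t → t ≤ T → 0 ≤ s →
      Metric.infDist (z + (t + s) • w') D ^ 2 ≤
        Metric.infDist (z + t • w') D ^ 2 + s ^ 2 * ‖w'‖ ^ 2 := by
    intro t s ht htT hs
    obtain ⟨p, hpD, hp⟩ := hC.exists_infDist_eq_dist ⟨z, hzD⟩ (z + t • w')
    have hyz : dist (z + t • w') z < min δ r / 2 := by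
      rw [dist_eq_norm, add_sub_cancel_left, norm_smul, Real.norm_of_nonneg ht]
      exact (mul_le_mul_of_nonneg_right htT (norm_nonneg _)).trans_lt h1
    have hpz : dist p z < min δ r := by
      have h4 : dist (z + t • w') p ≤ dist (z + t • w') z := hp ▸ Metric.infDist_le_dist_of_mem hzD
      have h5 := dist_triangle_left p z (z + t • w')
      linarith
    have hnormal : z + t • w' - p ∈ regularNormalCone C p := by
      refine sub_mem_regularNormalCone ?_
      have hb : ∀ᶠ q in 𝓝[C] p, q ∈ Metric.ball z r :=
        nhdsWithin_le_nhds (Metric.isOpen_ball.mem_nhds (hpz.trans_le (min_le_right _ _)))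
      filter_upwards [hb, self_mem_nhdsWithin] with q hq hqC
      exact hp ▸ Metric.infDist_le_dist_of_mem ⟨hqC, Metric.ball_subset_closedBall hq⟩
    have hin := hδ' p hpD.1 (hpz.trans_le (min_le_left _ _)) _ hnormal w' h3
    have h6 : Metric.infDist (z + (t + s) • w') D ≤ ‖(z + t • w' - p) + s • w'‖ := by
      refine (Metric.infDist_le_dist_of_mem hpD).trans_eq ?_
      rw [dist_eq_norm, add_smul]; congr 1; abel
    rw [hp, dist_eq_norm]
    calc Metric.infDist (z + (t + s) • w') D ^ 2 ≤ ‖(z + t • w' - p) + s • w'‖ ^ 2 := by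
          gcongr
          exact Metric.infDist_nonneg
      _ = ‖z + t • w' - p‖ ^ 2 + 2 * (s * inner ℝ (z + t • w' - p) w') + s ^ 2 * ‖w'‖ ^ 2 := by
          rw [norm_add_sq_real, inner_smul_right, norm_smul, mul_pow, Real.norm_eq_abs, sq_abs]
      _ ≤ ‖z + t • w' - p‖ ^ 2 + s ^ 2 * ‖w'‖ ^ 2 := by
          have := mul_nonpos_of_nonneg_of_nonpos hs hin
          linarith
  have bound : ∀ N : ℕ, Metric.infDist (z + T • w') D ^ 2 ≤ T ^ 2 * ‖w'‖ ^ 2 / ((N : ℝ) + 1) := by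
    intro N
    have hN : (0 : ℝ) < (N : ℝ) + 1 := by positivity
    have ind : ∀ j : ℕ, j ≤ N + 1 → Metric.infDist (z + ((j : ℝ) * (T / (N + 1))) • w') D ^ 2 ≤
        j * ((T / (N + 1)) ^ 2 * ‖w'‖ ^ 2) := by
      intro j
      induction j with
      | zero => simp [Metric.infDist_zero_of_mem hzD]
      | succ j ih =>
        intro hj
        have h7 := step (j * (T / (N + 1))) (T / (N + 1)) (by positivity) (by
          rw [← mul_div_assoc, div_le_iff₀ hN, mul_comm]
          have : (j : ℝ) ≤ (N : ℝ) + 1 := by exact_mod_cast (Nat.le_succ j).trans hj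
          gcongr) (by positivity)
        have h8 := ih (by omega)
        have h9 : ((j + 1 : ℕ) : ℝ) * (T / (N + 1)) = j * (T / (N + 1)) + T / (N + 1) := by
          push_cast; ring
        rw [h9]
        push_cast
        linarith
    have h10 := ind (N + 1) le_rfl
    have h11 : ((N + 1 : ℕ) : ℝ) * (T / (N + 1)) = T := by push_cast; field_simp
    rw [h11] at h10
    refine h10.trans_eq ?_
    push_cast
    field_simp
  have hlim : Tendsto (fun N : ℕ => T ^ 2 * ‖w'‖ ^ 2 / ((N : ℝ) + 1)) atTop (𝓝 0) := by
    simpa [div_eq_mul_inv] using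
      (tendsto_one_div_add_atTop_nhds_zero_nat (𝕜 := ℝ)).const_mul (T ^ 2 * ‖w'‖ ^ 2)
  have h0 : Metric.infDist (z + T • w') D = 0 :=
    pow_eq_zero_iff two_ne_zero |>.1 (le_antisymm (ge_of_tendsto' hlim bound) (sq_nonneg _))
  exact ((hC.mem_iff_infDist_zero ⟨z, hzD⟩).2 h0).1

/-- At a Clarke regular point, a vector in the polar of the regular normal cone becomes an interior
direction of `C` once any positive multiple of an interior tangent vector is added. -/
lemma ClarkeRegularAt.eventually_add_smul_mem [FiniteDimensional ℝ E] (hreg : ClarkeRegularAt C z)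
    {r : ℝ} (hr : 0 < r) (hC : IsClosed (C ∩ Metric.closedBall z r)) {w w₀ : E}
    (hw : ∀ v ∈ regularNormalCone C z, inner ℝ v w ≤ 0)
    (hw₀ : w₀ ∈ interior (tangentCone C z)) {s : ℝ} (hs : 0 < s) :
    ∀ᶠ q : ℝ × E in 𝓝[>] 0 ×ˢ 𝓝 (w + s • w₀), z + q.1 • q.2 ∈ C := by
  refine RobustOpt.eventually_add_smul_mem hr hreg.1 hC fun v hv hv0 => ?_
  rw [hreg.2] at hv
  rw [inner_add_right, inner_smul_right]
  have := mul_neg_of_pos_of_neg hs (inner_neg_of_mem_interior hv hv0 hw₀)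
  linarith [hw v hv]

/-- At a Clarke regular point where the tangent cone has an interior, the tangent cone is the polar
of the regular normal cone; in particular it is a convex cone. -/
lemma ClarkeRegularAt.mem_tangentCone_iff [FiniteDimensional ℝ E] (hreg : ClarkeRegularAt C z)
    {r : ℝ} (hr : 0 < r) (hC : IsClosed (C ∩ Metric.closedBall z r)) {w w₀ : E}
    (hw₀ : w₀ ∈ interior (tangentCone C z)) :
    w ∈ tangentCone C z ↔ ∀ v ∈ regularNormalCone C z, inner ℝ v w ≤ 0 := by
  refine ⟨fun hw v hv => inner_nonpos_of_mem_tangentCone hv hw, fun hw => ?_⟩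
  refine mem_tangentCone_of_eventually (w := fun j : ℕ => w + (1 / ((j : ℝ) + 1)) • w₀) ?_
    fun j => ?_
  · simpa using ((tendsto_one_div_add_atTop_nhds_zero_nat (𝕜 := ℝ)).smul_const w₀).const_add w
  · exact (hreg.eventually_add_smul_mem hr hC hw hw₀ (by positivity)).curry.mono
      fun t ht => ht.self_of_nhds

end TangentCone

/-! ### Functions that are Lipschitz near a point -/

section LocallyLipschitz

variable {E : Type*} [NormedAddCommGroup E] {f : E → ℝ} {x : E}

lemma LocallyLipschitzAt.exists_abs_sub_le (hf : LocallyLipschitzAt f x) :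
    ∃ K : ℝ, 0 ≤ K ∧ ∃ r : ℝ, 0 < r ∧ ∀ y ∈ Metric.closedBall x r, ∀ y' ∈ Metric.closedBall x r,
      |f y - f y'| ≤ K * ‖y - y'‖ := by
  obtain ⟨K, s, hs, hK⟩ := hf
  obtain ⟨r, hr, hrs⟩ := Metric.nhds_basis_closedBall.mem_iff.1 hs
  refine ⟨K, K.2, r, hr, fun y hy y' hy' => ?_⟩
  simpa [Real.dist_eq, dist_eq_norm] using hK.dist_le_mul y (hrs hy) y' (hrs hy')

lemma LocallyLipschitzAt.exists_continuousOn (hf : LocallyLipschitzAt f x) :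
    ∃ r : ℝ, 0 < r ∧ ContinuousOn f (Metric.closedBall x r) := by
  obtain ⟨K, s, hs, hK⟩ := hf
  obtain ⟨r, hr, hrs⟩ := Metric.nhds_basis_closedBall.mem_iff.1 hs
  exact ⟨r, hr, hK.continuousOn.mono hrs⟩

lemma LocallyLipschitzAt.exists_isClosed_epi (hf : LocallyLipschitzAt f x) :
    ∃ r : ℝ, 0 < r ∧
      IsClosed (epi f ∩ Metric.closedBall (WithLp.toLp 2 (x, f x) : WithLp 2 (E × ℝ)) r) := by
  obtain ⟨r, hr, hc⟩ := hf.exists_continuousOn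
  refine ⟨r, hr, ?_⟩
  have hmaps : MapsTo (fun p : WithLp 2 (E × ℝ) => p.fst)
      (Metric.closedBall (WithLp.toLp 2 (x, f x)) r) (Metric.closedBall x r) := by
    intro p hp
    rw [Metric.mem_closedBall, dist_eq_norm] at hp ⊢
    exact (WithLp.norm_fst_le E (p - WithLp.toLp 2 (x, f x))).trans hp
  have h1 : ContinuousOn (fun p : WithLp 2 (E × ℝ) => f p.fst)
      (Metric.closedBall (WithLp.toLp 2 (x, f x)) r) :=
    hc.comp (by fun_prop) hmaps
  have := Metric.isClosed_closedBall.isClosed_le h1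
    (g := fun p : WithLp 2 (E × ℝ) => p.snd) (by fun_prop)
  rw [inter_comm]
  exact this

variable [NormedSpace ℝ E]

/-- Difference quotients with small steps of a function that is Lipschitz near `x` are Lipschitz
in the direction. -/
lemma LocallyLipschitzAt.exists_quotient_le (hf : LocallyLipschitzAt f x) :
    ∃ K : ℝ, 0 ≤ K ∧ ∀ w w₀ : E, ∀ᶠ q : ℝ × E in 𝓝[>] 0 ×ˢ 𝓝 w,
      |(f (x + q.1 • q.2) - f x) / q.1 - (f (x + q.1 • w₀) - f x) / q.1| ≤ K * ‖q.2 - w₀‖ := by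
  obtain ⟨K, hK, r, hr, h⟩ := hf.exists_abs_sub_le
  refine ⟨K, hK, fun w w₀ => ?_⟩
  have h0 : Tendsto (fun q : ℝ × E => q.1) (𝓝[>] 0 ×ˢ 𝓝 w) (𝓝 0) :=
    tendsto_fst.mono_right nhdsWithin_le_nhds
  have h1 : Tendsto (fun q : ℝ × E => x + q.1 • q.2) (𝓝[>] 0 ×ˢ 𝓝 w) (𝓝 x) := by
    simpa using (h0.smul tendsto_snd).const_add x
  have h2 : Tendsto (fun q : ℝ × E => x + q.1 • w₀) (𝓝[>] 0 ×ˢ 𝓝 w) (𝓝 x) := by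
    simpa using (h0.smul_const w₀).const_add x
  have hpos : ∀ᶠ q : ℝ × E in 𝓝[>] 0 ×ˢ 𝓝 w, 0 < q.1 :=
    tendsto_fst.eventually self_mem_nhdsWithin
  filter_upwards [h1.eventually (Metric.closedBall_mem_nhds x hr),
    h2.eventually (Metric.closedBall_mem_nhds x hr), hpos] with q hq1 hq2 hq
  have := h _ hq1 _ hq2
  rw [add_sub_add_left_eq_sub, ← smul_sub, norm_smul, Real.norm_of_nonneg hq.le] at this
  rw [← sub_div, sub_sub_sub_cancel_right, abs_div, abs_of_pos hq, div_le_iff₀ hq]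
  linarith

lemma LocallyLipschitzAt.exists_abs_quotient_le (hf : LocallyLipschitzAt f x) :
    ∃ K : ℝ, 0 ≤ K ∧ ∀ w : E, ∀ᶠ q : ℝ × E in 𝓝[>] 0 ×ˢ 𝓝 w,
      |(f (x + q.1 • q.2) - f x) / q.1| ≤ K * ‖q.2‖ := by
  obtain ⟨K, hK, h⟩ := hf.exists_quotient_le
  refine ⟨K, hK, fun w => (h w 0).mono fun q hq => ?_⟩
  simpa using hq

end LocallyLipschitz

/-! ### Subderivatives of regular functions -/

section Subderivative

variable {E : Type*} [NormedAddCommGroup E] [InnerProductSpace ℝ E] {f : E → ℝ} {x : E}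

/-- The vertical direction is interior to the tangent cone of the epigraph of a Lipschitz
function: that cone contains every `(w, s)` with `s` above the Lipschitz constant times `‖w‖`. -/
lemma LocallyLipschitzAt.mem_interior_tangentCone_epi (hf : LocallyLipschitzAt f x) :
    (WithLp.toLp 2 (0, 1) : WithLp 2 (E × ℝ)) ∈
      interior (tangentCone (epi f) (WithLp.toLp 2 (x, f x))) := by
  obtain ⟨K, hK, h⟩ := hf.exists_abs_quotient_le
  have hopen : IsOpen {p : WithLp 2 (E × ℝ) | K * ‖p.fst‖ < p.snd} :=
    isOpen_lt (by fun_prop) (by fun_prop)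
  refine mem_interior.2 ⟨_, fun p hp => ?_, hopen, by simp⟩
  refine mem_tangentCone_of_eventually (w := fun _ => p) tendsto_const_nhds fun _ => ?_
  have h1 := (h p.fst).curry.mono fun t ht => ht.self_of_nhds
  filter_upwards [h1, self_mem_nhdsWithin] with t ht ht0
  have ht0' : (0 : ℝ) < t := ht0
  have hp' : K * ‖p.fst‖ < p.snd := hp
  have h2 : (f (x + t • p.fst) - f x) / t ≤ p.snd := (le_abs_self _).trans (ht.trans hp'.le)
  rw [div_le_iff₀ ht0'] at h2
  change f (x + t • p.fst) ≤ f x + t * p.snd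
  linarith

/-- A slope `s` that is attained asymptotically by difference quotients of `f` in the direction
`w` makes `(w, s)` polar to the regular normals of the epigraph. -/
lemma inner_epi_nonpos_of_tendsto {ι : Type*} {l : Filter ι} [l.NeBot] {τ : ι → ℝ} {w : ι → E}
    {s : ι → ℝ} {w₀ : E} {s₀ : ℝ} (hτ : Tendsto τ l (𝓝[>] 0)) (hw : Tendsto w l (𝓝 w₀))
    (hs : Tendsto s l (𝓝 s₀)) (h : ∀ᶠ i in l, (f (x + τ i • w i) - f x) / τ i ≤ s i)
    {v : WithLp 2 (E × ℝ)} (hv : v ∈ regularNormalCone (epi f) (WithLp.toLp 2 (x, f x))) :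
    inner ℝ v (WithLp.toLp 2 (w₀, s₀)) ≤ 0 := by
  refine inner_nonpos_of_tendsto hv hτ (w := fun i => WithLp.toLp 2 (w i, s i))
    (((WithLp.prod_continuous_toLp 2 E ℝ).tendsto _).comp (hw.prodMk_nhds hs)) ?_
  have hpos : ∀ᶠ i in l, 0 < τ i := hτ.eventually self_mem_nhdsWithin
  filter_upwards [h, hpos] with i hi hτi
  rw [div_le_iff₀ hτi] at hi
  change f (x + τ i • w i) ≤ f x + τ i * s i
  linarith

/-- By regularity, a vector `(w, s)` polar to the normals of the epigraph bounds all difference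
quotients in directions near `w`, up to an arbitrarily small error. -/
lemma SubdiffRegularAt.eventually_quotient_le [FiniteDimensional ℝ E] (hreg : SubdiffRegularAt f x)
    (hf : LocallyLipschitzAt f x) {w : E} {s s' : ℝ}
    (h : ∀ v ∈ regularNormalCone (epi f) (WithLp.toLp 2 (x, f x)),
      inner ℝ v (WithLp.toLp 2 (w, s)) ≤ 0) (hs : s < s') :
    ∀ᶠ q : ℝ × E in 𝓝[>] 0 ×ˢ 𝓝 w, (f (x + q.1 • q.2) - f x) / q.1 ≤ s' := by
  obtain ⟨r, hr, hC⟩ := hf.exists_isClosed_epi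
  have : FiniteDimensional ℝ (WithLp 2 (E × ℝ)) :=
    (WithLp.linearEquiv 2 ℝ (E × ℝ)).symm.finiteDimensional
  have key := ClarkeRegularAt.eventually_add_smul_mem hreg hr hC h hf.mem_interior_tangentCone_epi
    (sub_pos.2 hs)
  have hlim : Tendsto (fun q : ℝ × E => (q.1, (WithLp.toLp 2 (q.2, s') : WithLp 2 (E × ℝ))))
      (𝓝[>] 0 ×ˢ 𝓝 w)
      (𝓝[>] 0 ×ˢ 𝓝 (WithLp.toLp 2 (w, s) + (s' - s) • WithLp.toLp 2 (0, 1))) := by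
    refine tendsto_fst.prodMk ?_
    have h1 : (WithLp.toLp 2 (w, s) + (s' - s) • WithLp.toLp 2 (0, 1) : WithLp 2 (E × ℝ)) =
        WithLp.toLp 2 (w, s') := by
      rw [← WithLp.toLp_smul, ← WithLp.toLp_add]
      simp
    rw [h1]
    exact ((WithLp.prod_continuous_toLp 2 E ℝ).tendsto _).comp
      (tendsto_snd.prodMk_nhds tendsto_const_nhds)
  have hpos : ∀ᶠ q : ℝ × E in 𝓝[>] 0 ×ˢ 𝓝 w, 0 < q.1 :=
    tendsto_fst.eventually self_mem_nhdsWithin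
  filter_upwards [hlim.eventually key, hpos] with q hq hq0
  have h2 : f (x + q.1 • q.2) ≤ f x + q.1 * s' := hq
  rw [div_le_iff₀ hq0]
  linarith

lemma LocallyLipschitzAt.isBoundedUnder_quotient (hf : LocallyLipschitzAt f x) (w : E) :
    IsBoundedUnder (· ≤ ·) (𝓝[>] 0) (fun τ : ℝ => |(f (x + τ • w) - f x) / τ|) := by
  obtain ⟨K, -, h⟩ := hf.exists_abs_quotient_le
  exact ⟨K * ‖w‖, eventually_map.2 ((h w).curry.mono fun t ht => ht.self_of_nhds)⟩

/-- For a regular locally Lipschitz function the lower limit in the subderivative is a limit,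
uniformly with respect to perturbations of the direction. -/
lemma SubdiffRegularAt.tendsto_quotient [FiniteDimensional ℝ E] (hreg : SubdiffRegularAt f x)
    (hf : LocallyLipschitzAt f x) (w : E) :
    Tendsto (fun q : ℝ × E => (f (x + q.1 • q.2) - f x) / q.1) (𝓝[>] 0 ×ˢ 𝓝 w)
      (𝓝 (subderiv f x w)) := by
  have hbdd := isBoundedUnder_le_abs.1 (hf.isBoundedUnder_quotient w)
  have hlow : ∀ a < subderiv f x w, ∀ᶠ τ : ℝ in 𝓝[>] 0, a < (f (x + τ • w) - f x) / τ :=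
    fun a ha => eventually_lt_of_lt_liminf ha hbdd.2
  have hpolar : ∀ η : ℝ, 0 < η → ∀ v ∈ regularNormalCone (epi f) (WithLp.toLp 2 (x, f x)),
      inner ℝ v (WithLp.toLp 2 (w, subderiv f x w + η)) ≤ 0 := by
    intro η hη v hv
    have hfreq : ∃ᶠ τ : ℝ in 𝓝[>] 0, (f (x + τ • w) - f x) / τ < subderiv f x w + η :=
      frequently_lt_of_liminf_lt hbdd.1.isCoboundedUnder_ge (lt_add_of_pos_right _ hη)
    have : (𝓝[>] (0 : ℝ) ⊓
        𝓟 {τ : ℝ | (f (x + τ • w) - f x) / τ < subderiv f x w + η}).NeBot :=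
      frequently_mem_iff_neBot.1 hfreq
    refine inner_epi_nonpos_of_tendsto
      (l := 𝓝[>] (0 : ℝ) ⊓ 𝓟 {τ : ℝ | (f (x + τ • w) - f x) / τ < subderiv f x w + η})
      (τ := id) (w := fun _ => w)
      (s := fun _ => subderiv f x w + η) (tendsto_id.mono_left inf_le_left) tendsto_const_nhds
      tendsto_const_nhds ?_ hv
    filter_upwards [mem_inf_of_right (mem_principal_self _)] with τ hτ using le_of_lt hτ
  obtain ⟨K, hK, hlip⟩ := hf.exists_quotient_le
  refine tendsto_order.2 ⟨fun a ha => ?_, fun a ha => ?_⟩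
  · obtain ⟨c, hac, hc⟩ := exists_between ha
    have hclose : ∀ᶠ q : ℝ × E in 𝓝[>] 0 ×ˢ 𝓝 w, K * ‖q.2 - w‖ < c - a := by
      have : Tendsto (fun q : ℝ × E => K * ‖q.2 - w‖) (𝓝[>] 0 ×ˢ 𝓝 w) (𝓝 (K * ‖w - w‖)) :=
        ((tendsto_snd.sub_const w).norm).const_mul K
      rw [sub_self, norm_zero, mul_zero] at this
      exact this.eventually (gt_mem_nhds (sub_pos.2 hac))
    filter_upwards [tendsto_fst.eventually (hlow c hc), hclose, hlip w w] with q h1 h2 h3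
    have := (abs_le.1 h3).1
    linarith
  · obtain ⟨c, hc, hca⟩ := exists_between ha
    have := hreg.eventually_quotient_le hf
      (hpolar (c - subderiv f x w) (sub_pos.2 hc)) (s' := c + (a - c) / 2) (by linarith)
    filter_upwards [this] with q hq
    linarith

/-- The epigraph of the subderivative is the polar of the normal cone of the epigraph. -/
lemma SubdiffRegularAt.subderiv_le_iff [FiniteDimensional ℝ E] (hreg : SubdiffRegularAt f x)
    (hf : LocallyLipschitzAt f x) {w : E} {s : ℝ} :
    subderiv f x w ≤ s ↔ ∀ v ∈ regularNormalCone (epi f) (WithLp.toLp 2 (x, f x)),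
      inner ℝ v (WithLp.toLp 2 (w, s)) ≤ 0 := by
  have hlim := hreg.tendsto_quotient hf w
  constructor
  · intro h v hv
    refine inner_epi_nonpos_of_tendsto (τ := fun q : ℝ × E => q.1) (w := fun q => q.2)
      (s := fun q => (f (x + q.1 • q.2) - f x) / q.1 + (s - subderiv f x w))
      tendsto_fst tendsto_snd ?_ (.of_forall fun q => ?_) hv
    · simpa using hlim.add_const (s - subderiv f x w)
    · linarith
  · intro h
    refine le_of_forall_gt_imp_ge_of_dense fun s' hs' => ?_
    exact le_of_tendsto hlim (hreg.eventually_quotient_le hf h hs')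

lemma SubdiffRegularAt.subderiv_add_le [FiniteDimensional ℝ E] (hreg : SubdiffRegularAt f x)
    (hf : LocallyLipschitzAt f x) (w w' : E) :
    subderiv f x (w + w') ≤ subderiv f x w + subderiv f x w' := by
  refine (hreg.subderiv_le_iff hf).2 fun v hv => ?_
  have h1 := (hreg.subderiv_le_iff hf).1 (le_refl (subderiv f x w)) v hv
  have h2 := (hreg.subderiv_le_iff hf).1 (le_refl (subderiv f x w')) v hv
  rw [← Prod.mk_add_mk, WithLp.toLp_add, inner_add_right]
  linarith

lemma SubdiffRegularAt.subderiv_smul_le [FiniteDimensional ℝ E] (hreg : SubdiffRegularAt f x)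
    (hf : LocallyLipschitzAt f x) (w : E) {c : ℝ} (hc : 0 ≤ c) :
    subderiv f x (c • w) ≤ c * subderiv f x w := by
  refine (hreg.subderiv_le_iff hf).2 fun v hv => ?_
  have h1 := (hreg.subderiv_le_iff hf).1 (le_refl (subderiv f x w)) v hv
  rw [← smul_eq_mul, ← Prod.smul_mk, WithLp.toLp_smul, inner_smul_right]
  exact mul_nonpos_of_nonneg_of_nonpos hc h1

end Subderivative

/-! ### First order models of perturbed problems -/

section FirstOrderModel

lemma optValue_eq {X : Type*} {f : X → ℝ} {S : Set X} {x : X} (hx : x ∈ solutions f S) :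
    optValue f S = f x :=
  IsLeast.csInf_eq ⟨mem_image_of_mem f hx.1, by rintro _ ⟨y, hy, rfl⟩; exact hx.2 y hy⟩

variable {E : Type*} [NormedAddCommGroup E] [NormedSpace ℝ E]

/-- `min {g γ | γ ∈ Γ}` is a first order model, at the solution `x` of `min {f y | y ∈ Φ}`, of the
problems `min {f y | y ∈ R ε}` with `ε ↘ 0`.  The function `g` is a sublinear directional
derivative of `f` at `x`; every `γ ∈ Γ` is approximated by directions `γ'` with
`x + ε γ' ∈ R ε`; conversely, limits of the directions of points of `R ε` belong to `Γ`, and the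
directions of points of `Φ` are directions of recession of `Γ`. -/
structure FirstOrderModel (f g : E → ℝ) (x : E) (Φ Γ : Set E) (R : ℝ → Set E) : Prop where
  mem_solutions : x ∈ solutions f Φ
  tendsto_of_tendsto_value : ∀ y : ℕ → E, (∀ j, y j ∈ Φ) →
    Tendsto (fun j => f (y j)) atTop (𝓝 (f x)) → Tendsto y atTop (𝓝 x)
  locallyLipschitzAt : LocallyLipschitzAt f x
  tendsto_quotient : ∀ w, Tendsto (fun q : ℝ × E => (f (x + q.1 • q.2) - f x) / q.1)
    (𝓝[>] 0 ×ˢ 𝓝 w) (𝓝 (g w))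
  add_le : ∀ w w', g (w + w') ≤ g w + g w'
  smul_le : ∀ w, ∀ c : ℝ, 0 ≤ c → g (c • w) ≤ c * g w
  subset : ∀ ε, R ε ⊆ Φ
  isClosed : ∀ ε, IsClosed (R ε)
  nonempty : Γ.Nonempty
  exists_approx : ∀ γ ∈ Γ, ∀ a, g γ < a → ∃ γ', g γ' < a ∧ ∀ᶠ ε : ℝ in 𝓝[>] 0, x + ε • γ' ∈ R ε
  mem_of_frequently : ∀ γ, (∃ᶠ q : ℝ × E in 𝓝[>] 0 ×ˢ 𝓝 γ, x + q.1 • q.2 ∈ R q.1) → γ ∈ Γ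
  recession : ∀ w, (∃ᶠ q : ℝ × E in 𝓝[>] 0 ×ˢ 𝓝 w, x + q.1 • q.2 ∈ Φ) →
    ∀ γ ∈ Γ, ∀ c : ℝ, 0 ≤ c → γ + c • w ∈ Γ

namespace FirstOrderModel

variable {f g : E → ℝ} {x : E} {Φ Γ : Set E} {R : ℝ → Set E}

lemma eventually_exists_quotient_le (M : FirstOrderModel f g x Φ Γ R) {γ : E} (hγ : γ ∈ Γ) {a : ℝ}
    (ha : g γ < a) : ∀ᶠ ε in 𝓝[>] 0, ∃ p ∈ R ε, (f p - f x) / ε ≤ a := by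
  obtain ⟨γ', hγ', hR⟩ := M.exists_approx γ hγ a ha
  have h := (((M.tendsto_quotient γ').eventually (gt_mem_nhds hγ')).curry).mono
    fun t ht => ht.self_of_nhds
  filter_upwards [hR, h] with ε h1 h2 using ⟨_, h1, h2.le⟩

lemma exists_mem_of_value_le (M : FirstOrderModel f g x Φ Γ R) {V : Set E} (hV : V ∈ 𝓝 x) :
    ∃ η > 0, ∀ p ∈ Φ, f p ≤ f x + η → p ∈ V := by
  by_contra! h
  choose p hp hpf hpV using fun j : ℕ => h (1 / ((j : ℝ) + 1)) (by positivity)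
  have hlim : Tendsto (fun j => f (p j)) atTop (𝓝 (f x)) := by
    refine tendsto_of_tendsto_of_tendsto_of_le_of_le tendsto_const_nhds ?_
      (fun j => M.mem_solutions.2 _ (hp j)) hpf
    simpa using (tendsto_one_div_add_atTop_nhds_zero_nat (𝕜 := ℝ)).const_add (f x)
  obtain ⟨j, hj⟩ := ((M.tendsto_of_tendsto_value p hp hlim).eventually hV).exists
  exact hpV j hj

/-- The compactness condition confines minimizing sequences to a ball around `x` on which `f` is
continuous. -/
lemma eventually_solutions_nonempty [ProperSpace E] (M : FirstOrderModel f g x Φ Γ R) :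
    ∀ᶠ ε in 𝓝[>] 0, (solutions f (R ε)).Nonempty := by
  obtain ⟨γ, hγ⟩ := M.nonempty
  obtain ⟨r, hr, hc⟩ := M.locallyLipschitzAt.exists_continuousOn
  obtain ⟨η, hη, hΦ⟩ := M.exists_mem_of_value_le (Metric.closedBall_mem_nhds x hr)
  have hsmall : ∀ᶠ ε : ℝ in 𝓝[>] 0, ε * (g γ + 1) < η := by
    have : Tendsto (fun ε : ℝ => ε * (g γ + 1)) (𝓝 0) (𝓝 (0 * (g γ + 1))) :=
      tendsto_id.mul_const _
    rw [zero_mul] at this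
    exact (this.mono_left nhdsWithin_le_nhds).eventually (gt_mem_nhds hη)
  filter_upwards [M.eventually_exists_quotient_le hγ (lt_add_one _), hsmall, self_mem_nhdsWithin]
    with ε ⟨p, hp, hpε⟩ hε hε0
  have hε0' : (0 : ℝ) < ε := hε0
  rw [div_le_iff₀ hε0'] at hpε
  have hpη : f p ≤ f x + η := by linarith
  have hcomp : IsCompact (R ε ∩ Metric.closedBall x r) :=
    (isCompact_closedBall x r).inter_left (M.isClosed ε)
  obtain ⟨y, hy, hmin⟩ := hcomp.exists_isMinOn ⟨p, hp, hΦ p (M.subset ε hp) hpη⟩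
    (hc.mono inter_subset_right)
  refine ⟨y, hy.1, fun q hq => ?_⟩
  by_cases hqη : f q ≤ f x + η
  · exact hmin ⟨hq, hΦ q (M.subset ε hq) hqη⟩
  · exact ((hmin ⟨hp, hΦ p (M.subset ε hp) hpη⟩ : f y ≤ f p).trans hpη).trans (not_le.1 hqη).le

variable {ι : Type*} {l : Filter ι} {ε : ι → ℝ} {y : ι → E}

lemma eventually_quotient_le (M : FirstOrderModel f g x Φ Γ R) (hε : Tendsto ε l (𝓝[>] 0))
    (hy : ∀ᶠ i in l, y i ∈ solutions f (R (ε i))) {γ : E} (hγ : γ ∈ Γ) {a : ℝ} (ha : g γ < a) :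
    ∀ᶠ i in l, (f (y i) - f x) / ε i ≤ a := by
  have hpos : ∀ᶠ i in l, 0 < ε i := hε.eventually self_mem_nhdsWithin
  filter_upwards [hε.eventually (M.eventually_exists_quotient_le hγ ha), hy, hpos]
    with i ⟨p, hp, hpa⟩ hi hi0
  refine le_trans ?_ hpa
  gcongr
  exact hi.2 p hp

lemma tendsto_solutions (M : FirstOrderModel f g x Φ Γ R) (hε : Tendsto ε l (𝓝[>] 0))
    (hy : ∀ᶠ i in l, y i ∈ solutions f (R (ε i))) : Tendsto y l (𝓝 x) := by
  refine tendsto_def.2 fun V hV => ?_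
  obtain ⟨η, hη, hΦ⟩ := M.exists_mem_of_value_le hV
  obtain ⟨γ, hγ⟩ := M.nonempty
  have hpos : ∀ᶠ i in l, 0 < ε i := hε.eventually self_mem_nhdsWithin
  have hsmall : ∀ᶠ i in l, (g γ + 1) * ε i < η := by
    have := (hε.mono_right nhdsWithin_le_nhds).const_mul (g γ + 1)
    rw [mul_zero] at this
    exact this.eventually (gt_mem_nhds hη)
  filter_upwards [M.eventually_quotient_le hε hy hγ (lt_add_one _), hy, hpos, hsmall]
    with i h1 h2 h3 h4
  rw [div_le_iff₀ h3] at h1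
  exact hΦ _ (M.subset _ h2.1) (by linarith)

/-- Limits of the difference quotients of solutions are feasible for the model by
`mem_of_frequently`; comparison with the approximations of all other `γ ∈ Γ` shows that they are
optimal. -/
lemma tendsto_value_of_tendsto [l.NeBot] (M : FirstOrderModel f g x Φ Γ R)
    (hε : Tendsto ε l (𝓝[>] 0)) (hy : ∀ᶠ i in l, y i ∈ solutions f (R (ε i))) {γ : E}
    (hγ : Tendsto (fun i => (ε i)⁻¹ • (y i - x)) l (𝓝 γ)) :
    γ ∈ solutions g Γ ∧ Tendsto (fun i => (f (y i) - f x) / ε i) l (𝓝 (g γ)) := by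
  have hpos : ∀ᶠ i in l, 0 < ε i := hε.eventually self_mem_nhdsWithin
  have heq : ∀ᶠ i in l, x + ε i • ((ε i)⁻¹ • (y i - x)) = y i :=
    hpos.mono fun i hi => by rw [smul_inv_smul₀ hi.ne', add_sub_cancel]
  have hlim : Tendsto (fun i => (ε i, (ε i)⁻¹ • (y i - x))) l (𝓝[>] 0 ×ˢ 𝓝 γ) := hε.prodMk hγ
  have hval : Tendsto (fun i => (f (y i) - f x) / ε i) l (𝓝 (g γ)) :=
    ((M.tendsto_quotient γ).comp hlim).congr' (heq.mono fun i hi => by simp [hi])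
  refine ⟨⟨M.mem_of_frequently γ (hlim.frequently (Eventually.frequently ?_)), fun γ' hγ' => ?_⟩,
    hval⟩
  · filter_upwards [heq, hy] with i h1 h2
    simpa only [h1] using h2.1
  · exact le_of_forall_gt_imp_ge_of_dense fun a ha =>
      le_of_tendsto hval (M.eventually_quotient_le hε hy hγ' ha)

/-- The scaled solutions stay bounded: if their norms tended to infinity, a limit `w` of their
directions would be a direction of recession of `Γ` with `g w ≤ 0`, so that a whole ray would
consist of solutions of the model. -/
lemma exists_eventually_norm_le [ProperSpace E] (M : FirstOrderModel f g x Φ Γ R)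
    (hε : Tendsto ε l (𝓝[>] 0)) (hy : ∀ᶠ i in l, y i ∈ solutions f (R (ε i)))
    (hne : (solutions g Γ).Nonempty) (hbdd : Bornology.IsBounded (solutions g Γ)) :
    ∃ B : ℝ, ∀ᶠ i in l, ‖(ε i)⁻¹ • (y i - x)‖ ≤ B := by
  by_contra! h
  set s : ι → ℝ := fun i => ‖(ε i)⁻¹ • (y i - x)‖ with hs
  have hne' : (l ⊓ comap s atTop).NeBot := by
    refine (l.basis_sets.inf (atTop_basis.comap s)).neBot_iff.2 ?_
    rintro ⟨V, B⟩ ⟨hV, -⟩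
    obtain ⟨i, hi, hiV⟩ := ((h B).and_eventually hV).exists
    exact ⟨i, hiV, hi.le⟩
  obtain ⟨u, hu⟩ := Ultrafilter.exists_le (l ⊓ comap s atTop)
  have hul : (u : Filter ι) ≤ l := hu.trans inf_le_left
  have hsu : Tendsto s u atTop := tendsto_iff_comap.2 (hu.trans inf_le_right)
  replace hy := hul hy
  replace hε := hε.mono_left hul
  have hpos : ∀ᶠ i in (u : Filter ι), 0 < ε i := hε.eventually self_mem_nhdsWithin
  have hspos : ∀ᶠ i in (u : Filter ι), 0 < s i := hsu.eventually_gt_atTop 0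
  have hsphere : ∀ᶠ i in (u : Filter ι), (s i)⁻¹ • ((ε i)⁻¹ • (y i - x)) ∈
      Metric.sphere (0 : E) 1 := by
    filter_upwards [hspos] with i hi
    rw [mem_sphere_zero_iff_norm, norm_smul, norm_inv, Real.norm_of_nonneg hi.le]
    exact inv_mul_cancel₀ hi.ne'
  obtain ⟨w, hw, hwlim⟩ := (isCompact_sphere (0 : E) 1).ultrafilter_le_nhds
    (u.map fun i => (s i)⁻¹ • ((ε i)⁻¹ • (y i - x))) (le_principal_iff.2 hsphere)
  have heq : ∀ᶠ i in (u : Filter ι),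
      x + (ε i * s i) • ((s i)⁻¹ • ((ε i)⁻¹ • (y i - x))) = y i := by
    filter_upwards [hpos, hspos] with i hi hsi
    rw [mul_smul, smul_inv_smul₀ hsi.ne', smul_inv_smul₀ hi.ne', add_sub_cancel]
  have hstep : Tendsto (fun i => ε i * s i) u (𝓝[>] 0) := by
    refine tendsto_nhdsWithin_iff.2 ⟨?_, ?_⟩
    · have h0 : Tendsto (fun i => ‖y i - x‖) u (𝓝 0) :=
        tendsto_iff_norm_sub_tendsto_zero.1 (M.tendsto_solutions hε hy)
      refine h0.congr' ?_
      filter_upwards [hpos] with i hi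
      rw [hs]
      simp only
      rw [norm_smul, norm_inv, Real.norm_of_nonneg hi.le, mul_inv_cancel_left₀ hi.ne']
    · filter_upwards [hpos, hspos] with i hi hsi using mul_pos hi hsi
  have hlim : Tendsto (fun i => (ε i * s i, (s i)⁻¹ • ((ε i)⁻¹ • (y i - x)))) u
      (𝓝[>] 0 ×ˢ 𝓝 w) := hstep.prodMk hwlim
  have hrec := M.recession w (hlim.frequently (Eventually.frequently (by
    filter_upwards [heq, hy] with i h1 h2
    simpa only [h1] using M.subset _ h2.1)))
  obtain ⟨γ, hγ⟩ := hne
  have hgw : g w ≤ 0 := by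
    have h1 : Tendsto (fun i => (f (y i) - f x) / (ε i * s i)) u (𝓝 (g w)) :=
      ((M.tendsto_quotient w).comp hlim).congr' (heq.mono fun i hi => by simp [hi])
    have h2 : Tendsto (fun i => (g γ + 1) / s i) u (𝓝 0) := hsu.const_div_atTop _
    refine le_of_tendsto_of_tendsto h1 h2 ?_
    filter_upwards [M.eventually_quotient_le hε hy hγ.1 (lt_add_one _), hspos] with i hi hsi
    rw [← div_div]
    gcongr
  have hray : ∀ c : ℝ, 0 ≤ c → γ + c • w ∈ solutions g Γ := fun c hc =>
    ⟨hrec γ hγ.1 c hc, fun γ' hγ' => by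
      have h1 := M.add_le γ (c • w)
      have h2 := M.smul_le w c hc
      have h3 := hγ.2 γ' hγ'
      have h4 := mul_nonpos_of_nonneg_of_nonpos hc hgw
      linarith⟩
  obtain ⟨B, hB⟩ := hbdd.exists_norm_le
  have h1 := hB _ (hray (B + ‖γ‖ + 1) (by
    have := (norm_nonneg γ).trans (hB γ hγ)
    positivity))
  have hB0 : 0 ≤ B := (norm_nonneg γ).trans (hB γ hγ)
  have h2 : ‖(B + ‖γ‖ + 1) • w‖ = B + ‖γ‖ + 1 := by
    rw [norm_smul, mem_sphere_zero_iff_norm.1 hw, mul_one, Real.norm_of_nonneg (by positivity)]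
  have h3 : ‖(B + ‖γ‖ + 1) • w‖ ≤ ‖γ + (B + ‖γ‖ + 1) • w‖ + ‖γ‖ := by
    simpa using norm_sub_le (γ + (B + ‖γ‖ + 1) • w) γ
  linarith

lemma exists_tendsto_ultrafilter [ProperSpace E] (M : FirstOrderModel f g x Φ Γ R)
    (hε : Tendsto ε l (𝓝[>] 0)) (hy : ∀ᶠ i in l, y i ∈ solutions f (R (ε i)))
    (hne : (solutions g Γ).Nonempty) (hbdd : Bornology.IsBounded (solutions g Γ))
    {u : Ultrafilter ι} (hu : (u : Filter ι) ≤ l) :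
    ∃ γ ∈ solutions g Γ, Tendsto (fun i => (ε i)⁻¹ • (y i - x)) u (𝓝 γ) ∧
      Tendsto (fun i => (f (y i) - f x) / ε i) u (𝓝 (g γ)) := by
  obtain ⟨B, hB⟩ := M.exists_eventually_norm_le hε hy hne hbdd
  have hball : ∀ᶠ i in (u : Filter ι), (ε i)⁻¹ • (y i - x) ∈ Metric.closedBall (0 : E) B := by
    filter_upwards [hB.filter_mono hu] with i hi using mem_closedBall_zero_iff.2 hi
  obtain ⟨γ, -, hγ⟩ := (isCompact_closedBall (0 : E) B).ultrafilter_le_nhds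
    (u.map fun i => (ε i)⁻¹ • (y i - x)) (le_principal_iff.2 hball)
  obtain ⟨h1, h2⟩ := M.tendsto_value_of_tendsto (hε.mono_left hu) (hu hy) hγ
  exact ⟨γ, h1, hγ, h2⟩

lemma tendsto_value [ProperSpace E] (M : FirstOrderModel f g x Φ Γ R)
    (hε : Tendsto ε l (𝓝[>] 0)) (hy : ∀ᶠ i in l, y i ∈ solutions f (R (ε i)))
    (hbdd : Bornology.IsBounded (solutions g Γ)) {γ : E} (hγ : γ ∈ solutions g Γ) :
    Tendsto (fun i => (f (y i) - f x) / ε i) l (𝓝 (g γ)) := by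
  refine tendsto_iff_ultrafilter _ _ _ |>.2 fun u hu => ?_
  obtain ⟨γ', h1, -, h2⟩ := M.exists_tendsto_ultrafilter hε hy ⟨γ, hγ⟩ hbdd hu
  rwa [le_antisymm (hγ.2 γ' h1.1) (h1.2 γ hγ.1)]

lemma tendsto_direction [ProperSpace E] (M : FirstOrderModel f g x Φ Γ R)
    (hε : Tendsto ε l (𝓝[>] 0)) (hy : ∀ᶠ i in l, y i ∈ solutions f (R (ε i))) {γ : E}
    (hγ : solutions g Γ = {γ}) : Tendsto (fun i => (ε i)⁻¹ • (y i - x)) l (𝓝 γ) := by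
  refine tendsto_iff_ultrafilter _ _ _ |>.2 fun u hu => ?_
  obtain ⟨γ', h1, h2, -⟩ := M.exists_tendsto_ultrafilter hε hy (hγ ▸ singleton_nonempty γ)
    (hγ ▸ Bornology.isBounded_singleton) hu
  rw [hγ, mem_singleton_iff] at h1
  rwa [h1] at h2

lemma optValue_isLittleO [ProperSpace E] (M : FirstOrderModel f g x Φ Γ R)
    (hne : (solutions g Γ).Nonempty) (hbdd : Bornology.IsBounded (solutions g Γ)) :
    (fun ε : ℝ => optValue f (R ε) - (optValue f Φ + ε * optValue g Γ)) =o[𝓝[>] 0]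
      (fun ε : ℝ => ε) := by
  obtain ⟨γ, hγ⟩ := hne
  have hsol := M.eventually_solutions_nonempty
  have : Nonempty E := ⟨x⟩
  have hy : ∀ᶠ ε in 𝓝[>] (0 : ℝ),
      Classical.epsilon (fun y => y ∈ solutions f (R ε)) ∈ solutions f (R ε) :=
    hsol.mono fun ε hε => Classical.epsilon_spec hε
  have hlim := M.tendsto_value tendsto_id hy hbdd hγ
  refine isLittleO_iff.2 fun c hc => ?_
  filter_upwards [hy, hlim.eventually (Metric.ball_mem_nhds _ hc), self_mem_nhdsWithin]
    with ε h1 h2 h3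
  have h3' : (0 : ℝ) < ε := h3
  rw [optValue_eq h1, optValue_eq M.mem_solutions, optValue_eq hγ]
  simp only [id, Real.dist_eq] at h2
  rw [Real.norm_eq_abs, Real.norm_of_nonneg h3'.le]
  set d := f (Classical.epsilon fun y => y ∈ solutions f (R ε))
  calc |d - (f x + ε * g γ)| = |((d - f x) / ε - g γ) * ε| := by
        congr 1; field_simp; ring
    _ = |(d - f x) / ε - g γ| * ε := by rw [abs_mul, abs_of_pos h3']
    _ ≤ c * ε := by gcongr

end FirstOrderModel

end FirstOrderModel

/-! ### The tangential problem as a first order model -/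

section RobustProblem

lemma continuous_toEuclideanLin_apply {p q : ℕ} :
    Continuous fun a : Matrix (Fin p) (Fin q) ℝ × EuclideanSpace ℝ (Fin q) =>
      a.1.toEuclideanLin a.2 := by
  have h : Continuous fun a : Matrix (Fin p) (Fin q) ℝ × EuclideanSpace ℝ (Fin q) =>
      a.1.mulVec a.2.ofLp :=
    continuous_fst.matrix_mulVec ((PiLp.continuous_ofLp 2 _).comp continuous_snd)
  exact (PiLp.continuous_toLp 2 _).comp h

/-- A family of conditions that holds for small `ε > 0` locally uniformly in `u` holds for small
`ε > 0` simultaneously for all `u` in a compact set. -/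
lemma eventually_forall_mem_of_isCompact {X Y : Type*} [TopologicalSpace Y] {l : Filter X}
    {K : Set Y} (hK : IsCompact K) {P : X → Y → Prop}
    (h : ∀ u ∈ K, ∀ᶠ q : X × Y in l ×ˢ 𝓝 u, P q.1 q.2) : ∀ᶠ t in l, ∀ u ∈ K, P t u := by
  have h1 : {q : X × Y | P q.1 q.2} ∈ l ×ˢ 𝓝ˢ K := hK.mem_prod_nhdsSet_of_forall h
  have h2 : {q : X × Y | P q.1 q.2} ∈ l ×ˢ 𝓟 K := prod_mono_right l principal_le_nhdsSet h1
  exact eventually_prod_principal_iff.1 h2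

variable {n m : ℕ} {k : Fin m → ℕ}
    {A : (i : Fin m) → Matrix (Fin (k i)) (Fin n) ℝ}
    {b : (i : Fin m) → EuclideanSpace ℝ (Fin (k i))}
    {Q : (i : Fin m) → Set (EuclideanSpace ℝ (Fin (k i)))}
    {U : (i : Fin m) → Set (Matrix (Fin (k i)) (Fin n) ℝ × EuclideanSpace ℝ (Fin (k i)))}
    {x : EuclideanSpace ℝ (Fin n)}

lemma mem_robustSet_smul {ε : ℝ} {y : EuclideanSpace ℝ (Fin n)} :
    y ∈ robustSet A b Q (fun i => ε • U i) ↔ ∀ i, ∀ u ∈ U i,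
      (A i + ε • u.1).toEuclideanLin y - (b i + ε • u.2) ∈ Q i := by
  refine forall_congr' fun i => ?_
  exact forall_mem_image

lemma toEuclideanLin_expansion (i : Fin m)
    (u : Matrix (Fin (k i)) (Fin n) ℝ × EuclideanSpace ℝ (Fin (k i))) (ε : ℝ)
    (γ : EuclideanSpace ℝ (Fin n)) :
    (A i + ε • u.1).toEuclideanLin (x + ε • γ) - (b i + ε • u.2) =
      ((A i).toEuclideanLin x - b i) + ε • ((A i).toEuclideanLin γ +
        (u.1.toEuclideanLin x - u.2) + ε • u.1.toEuclideanLin γ) := by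
  simp only [map_add, map_smul, LinearMap.add_apply, LinearMap.smul_apply]
  module

lemma isClosed_robustSet_smul (hQ : ∀ i, IsClosed (Q i)) (ε : ℝ) :
    IsClosed (robustSet A b Q (fun i => ε • U i)) := by
  have : robustSet A b Q (fun i => ε • U i) = ⋂ i, ⋂ u ∈ U i,
      {y | (A i + ε • u.1).toEuclideanLin y - (b i + ε • u.2) ∈ Q i} := by
    ext y
    simp [mem_robustSet_smul]
  rw [this]
  refine isClosed_iInter fun i => isClosed_biInter fun u _ => (hQ i).preimage ?_
  exact (LinearMap.continuous_of_finiteDimensional _).sub continuous_const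

lemma robustSet_smul_subset (hU : ∀ i, (0, 0) ∈ U i) (ε : ℝ) :
    robustSet A b Q (fun i => ε • U i) ⊆ nominalSet A b Q := fun y hy i => by
  simpa using mem_robustSet_smul.1 hy i (0, 0) (hU i)

/-- A direction that satisfies all linearized constraints strictly leads into the robust feasible
sets; compactness of the uncertainty sets makes the admissible step size uniform. -/
lemma eventually_add_smul_mem_robustSet (hQ : ∀ i, IsClosed (Q i))
    (hz : ∀ i, (A i).toEuclideanLin x - b i ∈ Q i) (hU : ∀ i, IsCompact (U i))
    {γ : EuclideanSpace ℝ (Fin n)}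
    (hγ : ∀ i, ∀ u ∈ U i, ∀ v ∈ normalCone (Q i) ((A i).toEuclideanLin x - b i), v ≠ 0 →
      inner ℝ v ((A i).toEuclideanLin γ + (u.1.toEuclideanLin x - u.2)) < 0) :
    ∀ᶠ ε : ℝ in 𝓝[>] 0, x + ε • γ ∈ robustSet A b Q (fun i => ε • U i) := by
  simp only [mem_robustSet_smul]
  refine eventually_all.2 fun i => eventually_forall_mem_of_isCompact (hU i) fun u hu => ?_
  have key := eventually_add_smul_mem one_pos (hz i)
    ((hQ i).inter Metric.isClosed_closedBall) (hγ i u hu)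
  have hc : Continuous fun q : ℝ × (Matrix (Fin (k i)) (Fin n) ℝ × EuclideanSpace ℝ (Fin (k i))) =>
      (A i).toEuclideanLin γ + (q.2.1.toEuclideanLin x - q.2.2) +
        q.1 • q.2.1.toEuclideanLin γ := by
    have h1 : ∀ y : EuclideanSpace ℝ (Fin n), Continuous
        fun q : ℝ × (Matrix (Fin (k i)) (Fin n) ℝ × EuclideanSpace ℝ (Fin (k i))) =>
          q.2.1.toEuclideanLin y := fun y =>
      continuous_toEuclideanLin_apply.comp (by fun_prop :
        Continuous fun q : ℝ × (Matrix (Fin (k i)) (Fin n) ℝ × EuclideanSpace ℝ (Fin (k i))) =>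
          (q.2.1, y))
    have h2 := h1 x
    have h3 := h1 γ
    fun_prop
  have hlim := hc.tendsto ((0 : ℝ), u)
  rw [nhds_prod_eq] at hlim
  have hlim' := hlim.mono_left (prod_mono_left (𝓝 u) (nhdsWithin_le_nhds (s := Ioi (0 : ℝ))))
  simp only [zero_smul, add_zero] at hlim'
  filter_upwards [(tendsto_fst.prodMk hlim').eventually key] with q hq
  rw [toEuclideanLin_expansion]
  exact hq

/-- Feasibility passes to the limit: limits of scaled feasible directions satisfy the linearized
constraints, tested against regular normals. -/
lemma inner_nonpos_of_frequently_mem_robustSet {γ : EuclideanSpace ℝ (Fin n)}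
    (h : ∃ᶠ q : ℝ × EuclideanSpace ℝ (Fin n) in 𝓝[>] 0 ×ˢ 𝓝 γ,
      x + q.1 • q.2 ∈ robustSet A b Q (fun i => q.1 • U i)) (i : Fin m)
    {u : Matrix (Fin (k i)) (Fin n) ℝ × EuclideanSpace ℝ (Fin (k i))} (hu : u ∈ U i)
    {v : EuclideanSpace ℝ (Fin (k i))}
    (hv : v ∈ regularNormalCone (Q i) ((A i).toEuclideanLin x - b i)) :
    inner ℝ v ((A i).toEuclideanLin γ + (u.1.toEuclideanLin x - u.2)) ≤ 0 := by
  set S : Set (ℝ × EuclideanSpace ℝ (Fin n)) :=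
    {q | x + q.1 • q.2 ∈ robustSet A b Q (fun i => q.1 • U i)}
  have : ((𝓝[>] (0 : ℝ) ×ˢ 𝓝 γ) ⊓ 𝓟 S).NeBot := frequently_mem_iff_neBot.1 h
  have hc : Continuous fun q : ℝ × EuclideanSpace ℝ (Fin n) =>
      (A i).toEuclideanLin q.2 + (u.1.toEuclideanLin x - u.2) + q.1 • u.1.toEuclideanLin q.2 := by
    have h1 := (A i).toEuclideanLin.continuous_of_finiteDimensional
    have h2 := u.1.toEuclideanLin.continuous_of_finiteDimensional
    fun_prop
  have hlim := hc.tendsto ((0 : ℝ), γ)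
  rw [nhds_prod_eq] at hlim
  have hlim' := hlim.mono_left (prod_mono_left (𝓝 γ) (nhdsWithin_le_nhds (s := Ioi (0 : ℝ))))
  simp only [zero_smul, add_zero] at hlim'
  refine inner_nonpos_of_tendsto (l := (𝓝[>] (0 : ℝ) ×ˢ 𝓝 γ) ⊓ 𝓟 S) hv
    (tendsto_fst.mono_left inf_le_left) (hlim'.mono_left inf_le_left) ?_
  filter_upwards [mem_inf_of_right (mem_principal_self S)] with q hq
  have := mem_robustSet_smul.1 hq i u hu
  rwa [toEuclideanLin_expansion] at this

lemma robustSet_zero_eq (ε : ℝ) :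
    robustSet A b Q (fun _ => ε • {0}) = nominalSet A b Q := by
  ext y
  rw [mem_robustSet_smul]
  simp [nominalSet]

variable {f : EuclideanSpace ℝ (Fin n) → ℝ}

/-- The tangential problem is a first order model of the robust problems. -/
theorem firstOrderModel_tangentialSet (hU_zero : ∀ i, (0, 0) ∈ U i)
    (hx : x ∈ solutions f (nominalSet A b Q)) (hQ_closed : ∀ i, IsClosed (Q i))
    (hQ_regular : ∀ i, ClarkeRegularAt (Q i) ((A i).toEuclideanLin x - b i))
    (hU_compact : ∀ i, IsCompact (U i))
    (hCQ : ∃ γ' : EuclideanSpace ℝ (Fin n), ∀ i, (A i).toEuclideanLin γ' ∈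
      interior (tangentCone (Q i) ((A i).toEuclideanLin x - b i)))
    (hcompactness : ∀ y : ℕ → EuclideanSpace ℝ (Fin n), (∀ j, y j ∈ nominalSet A b Q) →
      Tendsto (fun j => f (y j)) atTop (𝓝 (f x)) → Tendsto y atTop (𝓝 x))
    (hf_lip : LocallyLipschitzAt f x) (hf_reg : SubdiffRegularAt f x) :
    FirstOrderModel f (subderiv f x) x (nominalSet A b Q) (tangentialSet A b Q U x)
      (fun ε => robustSet A b Q (fun i => ε • U i)) := by
  obtain ⟨γ', hγ'⟩ := hCQ
  have hiff : ∀ i w, w ∈ tangentCone (Q i) ((A i).toEuclideanLin x - b i) ↔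
      ∀ v ∈ regularNormalCone (Q i) ((A i).toEuclideanLin x - b i), inner ℝ v w ≤ 0 := fun i w =>
    (hQ_regular i).mem_tangentCone_iff one_pos ((hQ_closed i).inter Metric.isClosed_closedBall)
      (hγ' i)
  refine
    { mem_solutions := hx
      tendsto_of_tendsto_value := hcompactness
      locallyLipschitzAt := hf_lip
      tendsto_quotient := hf_reg.tendsto_quotient hf_lip
      add_le := hf_reg.subderiv_add_le hf_lip
      smul_le := fun w c hc => hf_reg.subderiv_smul_le hf_lip w hc
      subset := robustSet_smul_subset hU_zero
      isClosed := isClosed_robustSet_smul hQ_closed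
      nonempty := ?_
      exists_approx := fun γ hγ a ha => ?_
      mem_of_frequently := fun γ h i u hu => (hiff i _).2 fun v hv =>
        inner_nonpos_of_frequently_mem_robustSet h i hu hv
      recession := fun w hw γ hγ c hc i u hu => (hiff i _).2 fun v hv => ?_ }
  · -- A large multiple of `γ'` outweighs the bounded perturbations `ΔA x - Δb`.
    have key : ∀ i, ∀ᶠ s : ℝ in atTop, ∀ u ∈ U i,
        (A i).toEuclideanLin (s • γ') + (u.1.toEuclideanLin x - u.2) ∈
          tangentCone (Q i) ((A i).toEuclideanLin x - b i) := by
      intro i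
      obtain ⟨δ, hδ, hball⟩ := Metric.mem_nhds_iff.1 (mem_interior_iff_mem_nhds.1 (hγ' i))
      have hc : Continuous
          fun u : Matrix (Fin (k i)) (Fin n) ℝ × EuclideanSpace ℝ (Fin (k i)) =>
            u.1.toEuclideanLin x - u.2 :=
        (continuous_toEuclideanLin_apply.comp (continuous_fst.prodMk continuous_const)).sub
          continuous_snd
      obtain ⟨B, hB⟩ := ((hU_compact i).image hc).isBounded.exists_norm_le
      filter_upwards [eventually_gt_atTop 0, eventually_gt_atTop (B / δ)] with s hs hsB u hu
      have h1 : (A i).toEuclideanLin γ' + s⁻¹ • (u.1.toEuclideanLin x - u.2) ∈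
          tangentCone (Q i) ((A i).toEuclideanLin x - b i) := by
        refine hball ?_
        rw [Metric.mem_ball, dist_eq_norm, add_sub_cancel_left, norm_smul, norm_inv,
          Real.norm_of_nonneg hs.le, inv_mul_lt_iff₀ hs]
        exact (hB _ (mem_image_of_mem _ hu)).trans_lt ((div_lt_iff₀ hδ).1 hsB)
      refine (hiff i _).2 fun v hv => ?_
      have h2 := (hiff i _).1 h1 v hv
      have h3 : (A i).toEuclideanLin (s • γ') + (u.1.toEuclideanLin x - u.2) =
          s • ((A i).toEuclideanLin γ' + s⁻¹ • (u.1.toEuclideanLin x - u.2)) := by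
        rw [smul_add, smul_inv_smul₀ hs.ne', map_smul]
      rw [h3, inner_smul_right]
      exact mul_nonpos_of_nonneg_of_nonpos hs.le h2
    obtain ⟨s, hs⟩ := (eventually_all.2 key).exists
    exact ⟨s • γ', hs⟩
  · obtain ⟨s, hs, hsa⟩ : ∃ s : ℝ, 0 < s ∧ subderiv f x γ + s * subderiv f x γ' < a := by
      have : Tendsto (fun s : ℝ => subderiv f x γ + s * subderiv f x γ') (𝓝 0)
          (𝓝 (subderiv f x γ + 0 * subderiv f x γ')) :=
        (tendsto_id.mul_const _).const_add _
      rw [zero_mul, add_zero] at this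
      obtain ⟨s, h1, h2⟩ := (((this.mono_left nhdsWithin_le_nhds).eventually
        (gt_mem_nhds ha)).and (self_mem_nhdsWithin (s := Ioi (0 : ℝ)))).exists
      exact ⟨s, h2, h1⟩
    refine ⟨γ + s • γ', ?_, ?_⟩
    · have h1 := hf_reg.subderiv_add_le hf_lip γ (s • γ')
      have h2 := hf_reg.subderiv_smul_le hf_lip γ' hs.le
      linarith
    · refine eventually_add_smul_mem_robustSet hQ_closed (fun i => (hQ_regular i).1) hU_compact
        fun i u hu v hv hv0 => ?_
      rw [(hQ_regular i).2] at hv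
      have h1 := (hiff i _).1 (hγ i u hu) v hv
      have h2 := mul_neg_of_pos_of_neg hs (inner_neg_of_mem_interior hv hv0 (hγ' i))
      rw [map_add, map_smul, add_right_comm, inner_add_right, inner_smul_right]
      linarith
  · have h1 := (hiff i _).1 (hγ i u hu) v hv
    have h2 : inner ℝ v ((A i).toEuclideanLin w) ≤ 0 := by
      have := inner_nonpos_of_frequently_mem_robustSet (A := A) (b := b) (Q := Q)
        (U := fun _ => {0}) (x := x) (γ := w) (by simpa only [robustSet_zero_eq] using hw) i
        (mem_singleton 0) hv
      simpa using this
    rw [map_add, map_smul, add_right_comm, inner_add_right, inner_smul_right]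
    linarith [mul_nonpos_of_nonneg_of_nonpos hc h2]

end RobustProblem

end RobustOpt

theorem theorem5p2 {n m : ℕ} {k : Fin m → ℕ}
    (A : (i : Fin m) → Matrix (Fin (k i)) (Fin n) ℝ)
    (b : (i : Fin m) → EuclideanSpace ℝ (Fin (k i)))
    (Q : (i : Fin m) → Set (EuclideanSpace ℝ (Fin (k i))))
    (U : (i : Fin m) → Set (Matrix (Fin (k i)) (Fin n) ℝ × EuclideanSpace ℝ (Fin (k i))))
    (f : EuclideanSpace ℝ (Fin n) → ℝ)
    (xbar : EuclideanSpace ℝ (Fin n))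
    (Φ Γ Γbar : Set (EuclideanSpace ℝ (Fin n)))
    (hΦ : Φ = nominalSet A b Q)
    (hΓ : Γ = tangentialSet A b Q U xbar)
    (hΓbar : Γbar = solutions (subderiv f xbar) Γ)
    -- the nominal data belong to the uncertainty set
    (hU_zero : ∀ i, (0, 0) ∈ U i)
    -- `xbar` solves the nominal problem
    (hxbar : xbar ∈ solutions f Φ)
    (hQ_closed : ∀ i, IsClosed (Q i))
    (hQ_regular : ∀ i, ClarkeRegularAt (Q i) ((A i).toEuclideanLin xbar - b i))
    (hU_compact : ∀ i, IsCompact (U i))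
    (hU_convex : ∀ i, Convex ℝ (U i))
    (hΓbar_bounded : Bornology.IsBounded Γbar)
    (hCQ : ∃ γ' : EuclideanSpace ℝ (Fin n), ∀ i, (A i).toEuclideanLin γ' ∈
      interior (tangentCone (Q i) ((A i).toEuclideanLin xbar - b i)))
    (hcompactness : ∀ x : ℕ → EuclideanSpace ℝ (Fin n), (∀ j, x j ∈ Φ) →
      Tendsto (fun j => f (x j)) atTop (𝓝 (f xbar)) → Tendsto x atTop (𝓝 xbar))
    (hf_lip : LocallyLipschitzAt f xbar)
    (hf_reg : SubdiffRegularAt f xbar) :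
    -- cluster points of difference quotients of optimal solutions
    (∀ (ε : ℕ → ℝ) (x : ℕ → EuclideanSpace ℝ (Fin n)),
      (∀ j, 0 < ε j) → Tendsto ε atTop (𝓝 0) →
      (∀ j, x j ∈ solutions f (robustSet A b Q (fun i => ε j • U i))) →
      ∀ γ, MapClusterPt γ atTop (fun j => (ε j)⁻¹ • (x j - xbar)) → γ ∈ Γbar) ∧
    -- the robust problem has an optimal solution, hence a finite value, for all small `ε > 0`
    (∀ᶠ ε in 𝓝[>] (0 : ℝ), (solutions f (robustSet A b Q (fun i => ε • U i))).Nonempty) ∧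
    -- first order expansion of the optimal value
    (Γbar.Nonempty →
      (fun ε : ℝ => optValue f (robustSet A b Q (fun i => ε • U i)) -
        (optValue f Φ + ε * optValue (subderiv f xbar) Γ)) =o[𝓝[>] 0] (fun ε : ℝ => ε)) ∧
    -- first order expansion of the optimal solutions when the tangential problem has only one
    (∀ γbar, Γbar = {γbar} →
      (∀ (ε : ℕ → ℝ) (x : ℕ → EuclideanSpace ℝ (Fin n)),
        (∀ j, 0 < ε j) → Tendsto ε atTop (𝓝 0) →
        (∀ j, x j ∈ solutions f (robustSet A b Q (fun i => ε j • U i))) →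
        Tendsto (fun j => (ε j)⁻¹ • (x j - xbar)) atTop (𝓝 γbar)) ∧
      (∀ x : ℝ → EuclideanSpace ℝ (Fin n),
        (∀ᶠ ε in 𝓝[>] (0 : ℝ), x ε ∈ solutions f (robustSet A b Q (fun i => ε • U i))) →
        Tendsto (fun ε => ε⁻¹ • (x ε - xbar)) (𝓝[>] 0) (𝓝 γbar) ∧
        (fun ε : ℝ => x ε - (xbar + ε • γbar)) =o[𝓝[>] 0] (fun ε : ℝ => ε))) := by
  subst hΦ hΓ hΓbar
  have M := firstOrderModel_tangentialSet hU_zero hxbar hQ_closed hQ_regular hU_compact hCQ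
    hcompactness hf_lip hf_reg
  refine ⟨fun ε x hε0 hε hx γ hγ => ?_, M.eventually_solutions_nonempty,
    fun hne => M.optValue_isLittleO hne hΓbar_bounded, fun γbar hγbar => ⟨fun ε x hε0 hε hx => ?_,
      fun x hx => ?_⟩⟩
  · obtain ⟨u, hu, huγ⟩ := mapClusterPt_iff_ultrafilter.1 hγ
    exact (M.tendsto_value_of_tendsto
      ((tendsto_nhdsWithin_iff.2 ⟨hε, .of_forall hε0⟩).mono_left hu) (.of_forall hx) huγ).1
  · exact M.tendsto_direction (tendsto_nhdsWithin_iff.2 ⟨hε, .of_forall hε0⟩) (.of_forall hx)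
      hγbar
  · have hlim := M.tendsto_direction tendsto_id hx hγbar
    refine ⟨hlim, isLittleO_iff.2 fun c hc => ?_⟩
    filter_upwards [hlim.eventually (Metric.ball_mem_nhds _ hc), self_mem_nhdsWithin] with ε h1 h2
    have hε : (0 : ℝ) < ε := h2
    have h3 : x ε - (xbar + ε • γbar) = ε • (ε⁻¹ • (x ε - xbar) - γbar) := by
      rw [smul_sub, smul_inv_smul₀ hε.ne', sub_sub]
    rw [h3, norm_smul, mul_comm]
    rw [dist_eq_norm] at h1
    gcongr
    exact h1.le
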